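/- A dimension function is a non-decreasing continuous function $h:[0,\infty)\to[0,\infty)$ with $h(0)=0$. For $A\subseteq\mathbb{R}^2$ let $$\mathcal{H}^h(A)=\sup_{\delta>0}\ \inf\Big\{\sum_i h(\operatorname{diam}A_i)\ :\ A\subseteq\bigcup_{i=1}^\infty A_i,\ \operatorname{diam}A_i<\delta\Big\}$$ be the associated Hausdorff measure. A set $E\subseteq\mathbb{R}^2$ is called an $F_h$-set if for every direction $e$ in the unit circle there is a line segment $\ell_e$ in the direction of $e$ such that $\mathcal{H}^h(\ell_e\cap E)>0$. **Theorem.** Let $\mathfrak{h}$ be a dimension function with $\mathfrak{h}(x)=\dfrac{1}{\log(1/x)}$ for all sufficiently small $x>0$. Then there is an $F_{\mathfrak{h}}$-set $E\subseteq\mathbb{R}^2$ with $\dim_H(E)\le\frac12$. Moreover, the value $\frac12$ is sharp: every $F_{\mathfrak{h}}$-set $E\subseteq\mathbb{R}^2$ satisfies $\dim_H(E)\ge\frac12$. -/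

import Mathlib

open MeasureTheory Topology Filter
open scoped NNReal ENNReal

/-- A dimension function: a non-decreasing continuous `h : [0, ∞) → [0, ∞)` with `h 0 = 0`. -/
structure IsDimensionFunction (h : ℝ≥0 → ℝ≥0) : Prop where
  mono : Monotone h
  cont : Continuous h
  zero : h 0 = 0

/-- The function `h` is given by `x ↦ 1 / log (1 / x)` for all sufficiently small `x > 0`.
(The formula does not define a function on all of `[0, ∞)`; Hausdorff measures depend only on the
values of `h` near `0`.) -/
def IsInverseLogNearZero (h : ℝ≥0 → ℝ≥0) : Prop :=
  ∀ᶠ x : ℝ≥0 in 𝓝[>] 0, (h x : ℝ) = 1 / Real.log (1 / (x : ℝ))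

/-- The generalized Hausdorff measure `ℋ^h` on the Euclidean plane, as an outer measure defined on
all subsets: `ℋ^h(E) = sup_{δ > 0} inf {∑ i, h (diam (E i)) : E ⊆ ⋃ i, E i, diam (E i) ≤ δ}`.
Sets of infinite diameter never occur in the coverings for finite `δ`, so the value of the gauge
at `∞` is irrelevant. -/
noncomputable def hausdorffOuterMeasure (h : ℝ≥0 → ℝ≥0) :
    OuterMeasure (EuclideanSpace ℝ (Fin 2)) :=
  OuterMeasure.mkMetric fun r : ℝ≥0∞ => (h r.toNNReal : ℝ≥0∞)

/-- `E ⊆ ℝ²` is an `F_h`-set: for every direction `e` in the unit circle there is a line segment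
`ℓ_e` in the direction of `e` such that `ℋ^h(ℓ_e ∩ E) > 0`. -/
def IsFurstenbergSet (h : ℝ≥0 → ℝ≥0) (E : Set (EuclideanSpace ℝ (Fin 2))) : Prop :=
  ∀ e ∈ Metric.sphere (0 : EuclideanSpace ℝ (Fin 2)) 1,
    ∃ (a : EuclideanSpace ℝ (Fin 2)) (L : ℝ), 0 < L ∧
      0 < hausdorffOuterMeasure h (segment ℝ a (a + L • e) ∩ E)

/-- There is a dimension function given by `1 / log (1 / x)` near `0`. -/
theorem exists_isDimensionFunction_inverseLog :
    ∃ h : ℝ≥0 → ℝ≥0, IsDimensionFunction h ∧ IsInverseLogNearZero h := by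
  set c : ℝ := Real.exp (-1) with hc
  have hc0 : 0 < c := Real.exp_pos _
  have key : ∀ x : ℝ, 0 < x → x ≤ c → 1 ≤ Real.log (1 / x) := by
    intro x hx hxc
    rw [one_div, Real.log_inv]
    have := Real.log_le_log hx hxc
    rw [hc, Real.log_exp] at this
    linarith
  have hmin : ∀ x : ℝ≥0, x ≠ 0 → 0 < min (x : ℝ) c := fun x hx =>
    lt_min (by positivity) hc0
  refine ⟨fun x => (1 / Real.log (1 / min (x : ℝ) c)).toNNReal, ⟨?_, ?_, ?_⟩, ?_⟩
  · intro x y hxy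
    apply Real.toNNReal_le_toNNReal
    rcases eq_or_ne x 0 with rfl | hx
    · rcases eq_or_ne y 0 with rfl | hy
      · exact le_rfl
      · have := key _ (hmin y hy) (min_le_right _ _)
        have h0 : min ((0 : ℝ≥0) : ℝ) c = 0 := by simp [hc0.le]
        rw [h0]
        simp only [div_zero, Real.log_zero]
        positivity
    · have hy : y ≠ 0 := (lt_of_lt_of_le (pos_iff_ne_zero.2 hx) hxy).ne'
      have h1 := key _ (hmin y hy) (min_le_right _ _)
      have hle : min (x : ℝ) c ≤ min (y : ℝ) c := min_le_min_right _ (by exact_mod_cast hxy)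
      apply one_div_le_one_div_of_le (by linarith)
      apply Real.log_le_log (one_div_pos.2 (hmin y hy))
      exact one_div_le_one_div_of_le (hmin x hx) hle
  · refine continuous_real_toNNReal.comp (continuous_iff_continuousAt.2 fun x => ?_)
    rcases eq_or_ne x 0 with rfl | hx
    · have hlim : Tendsto (fun t : ℝ => 1 / Real.log (1 / t)) (𝓝 0) (𝓝 0) := by
        have h' : ContinuousAt (fun t : ℝ => 1 / Real.log (1 / t)) 0 := by
          rw [continuousAt_iff_punctured_nhds]
          simp only [one_div, Real.log_inv, Real.log_zero, inv_zero]
          exact (tendsto_neg_atBot_atTop.comp Real.tendsto_log_nhdsNE_zero).inv_tendsto_atTop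
        simpa [ContinuousAt] using h'
      have hcont : Tendsto (fun x : ℝ≥0 => min (x : ℝ) c) (𝓝 0) (𝓝 0) := by
        have : Continuous (fun x : ℝ≥0 => min (x : ℝ) c) := by fun_prop
        simpa [hc0.le] using this.tendsto 0
      have h0 : (1 / Real.log (1 / min ((0 : ℝ≥0) : ℝ) c)) = 0 := by simp [hc0.le]
      rw [ContinuousAt, h0]
      exact hlim.comp hcont
    · have h1 := key _ (hmin x hx) (min_le_right _ _)
      have h2 := (hmin x hx).ne'
      have h3 : ContinuousAt (fun x : ℝ≥0 => min (x : ℝ) c) x := by fun_prop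
      refine continuousAt_const.div ((continuousAt_const.div h3 h2).log ?_) (by linarith)
      exact one_div_ne_zero h2
  · simp [hc0.le]
  · have hmem : ∀ᶠ x : ℝ≥0 in 𝓝[>] 0, (x : ℝ) < c :=
      eventually_nhdsWithin_of_eventually_nhds
        (NNReal.continuous_coe.tendsto 0 |>.eventually_lt_const (by simpa using hc0))
    filter_upwards [hmem, self_mem_nhdsWithin] with x hx hx0
    have hx0' : 0 < (x : ℝ) := by exact_mod_cast hx0
    have := key x hx0' hx.le
    rw [min_eq_left hx.le, Real.coe_toNNReal _ (by positivity)]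

/-! Lower bound. Suppose `dimH E < s < 1/2`. Cover `E` by sets of diameter at most `w_i ^ (1/s)`
with `∑ w_i` tiny, and sort them into hyperdyadic classes `q^c ≤ -log w_i < q^(c+1)`, with `q > 1`
close to 1. Two sets of the same class that are `exp(-η q^c)`-separated are joined by lines whose
slopes have measure `≲ w_i w_m`, because `1/s > 2`. So outside a small set of slopes, each class
meets a line in a set of diameter at most `exp(-η q^c)`. The gauge of that is about `1/(η q^c)`, a
convergent geometric series whose tails show that the intersection is null
(`exists_exceptional_slopes`).

Construction. Let `P = powTower i`, `N = 2 ^ powTower (i + 1) = 2^(2^P)`, `M = 16^P` and `n = P N`;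
thus `P` and `M` are `N^o(1)`. Numbers `x` with sparse base 4 digits lie within `N⁻²` of some `u/M`,
yet have enough free digits to carry positive measure for the gauge. On each line `Y = s X + α` take
the points with `X = 1/(x + √2)`, so that `Y = X (s + α (x + √2))`. If `s ≈ (k - j√2)/n` and `α ≈
j/n`, the terms in `√2` cancel and `Y ≈ X (j u + k M)/(n M)`. Only `u` and the integer `j u + k M`
matter, instead of the pair `(j, k)`: about `N^(1+o(1))` balls of radius `N⁻²` suffice, which gives
dimension at most `1/2`. Since `√2` is badly approximable, every slope is approximable in this way
with `j/n` in any prescribed interval, once `i` is large; Baire then provides, for each slope, an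
intercept that works at infinitely many scales (`exists_intercept`). -/

/-! ### Lower bound: exceptional slopes and hyperdyadic classes. -/

/-- The values of an inverse logarithmic gauge along `exp (-(η * q ^ j))` are summable. -/
theorem IsInverseLogNearZero.tsum_exp_ne_top {h : ℝ≥0 → ℝ≥0} (hlog : IsInverseLogNearZero h)
    {η q : ℝ} (hη : 0 < η) (hq : 1 < q) :
    ∑' j : ℕ, (h (Real.toNNReal (Real.exp (-(η * q ^ j)))) : ℝ≥0∞) ≠ ∞ := by
  rw [ENNReal.tsum_coe_ne_top_iff_summable, ← NNReal.summable_coe]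
  have hlim : Tendsto (fun j : ℕ => Real.toNNReal (Real.exp (-(η * q ^ j)))) atTop (𝓝[>] 0) := by
    refine tendsto_nhdsWithin_iff.2 ⟨?_, Eventually.of_forall fun j => by
      simpa using Real.exp_pos _⟩
    have h1 : Tendsto (fun j : ℕ => η * q ^ j) atTop atTop :=
      (tendsto_pow_atTop_atTop_of_one_lt hq).const_mul_atTop hη
    have h2 := (Real.tendsto_exp_neg_atTop_nhds_zero.comp h1)
    have h3 := (continuous_real_toNNReal.tendsto 0).comp h2
    simpa [Function.comp_def] using h3
  have hev := hlim.eventually hlog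
  have hsum : Summable (fun j : ℕ => η⁻¹ * (q⁻¹) ^ j) :=
    (summable_geometric_of_lt_one (by positivity) (inv_lt_one_of_one_lt₀ hq)).mul_left _
  refine Summable.of_norm_bounded_eventually_nat hsum ?_
  filter_upwards [hev] with j hj
  rw [hj, Real.coe_toNNReal _ (Real.exp_pos _).le, one_div, one_div, Real.log_inv, Real.log_exp,
    neg_neg, Real.norm_of_nonneg (by positivity), mul_inv, inv_pow]

/-- A set of Hausdorff dimension less than `s` has coverings with arbitrarily small `s`-sums; the
terms of the sum are replaced by positive weights. -/
theorem exists_cover_of_dimH_lt {X : Type*} [MetricSpace X] {E : Set X} {s : ℝ≥0}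
    (hs : dimH E < s) {ε : ℝ≥0∞} (hε : ε ≠ 0) :
    ∃ (U : ℕ → Set X) (w : ℕ → ℝ≥0), (∀ i, 0 < w i) ∧ E ⊆ ⋃ i, U i ∧
      (∀ i, ∀ x ∈ U i, ∀ y ∈ U i, dist x y ≤ (w i : ℝ) ^ (s : ℝ)⁻¹) ∧
      ∑' i, (w i : ℝ≥0∞) ≤ ε := by
  borelize X
  have hs0 : 0 < s := by
    rcases eq_or_ne s 0 with rfl | h
    · simp at hs
    · exact pos_iff_ne_zero.2 h
  have hs0' : (0 : ℝ) < s := by exact_mod_cast hs0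
  have h0 : μH[(s : ℝ)] E = 0 := hausdorffMeasure_of_dimH_lt hs
  have hlt : ⨅ (t : ℕ → Set X) (_ : E ⊆ ⋃ n, t n) (_ : ∀ n, Metric.ediam (t n) ≤ 1),
          ∑' n, ⨆ _ : (t n).Nonempty, Metric.ediam (t n) ^ (s : ℝ) < ε / 2 := by
    refine lt_of_le_of_lt ?_ (pos_iff_ne_zero.2 (ENNReal.div_ne_zero.2 ⟨hε, by simp⟩))
    rw [← h0, Measure.hausdorffMeasure_apply]
    exact le_iSup₂ (f := fun (r : ℝ≥0∞) (_ : 0 < r) =>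
      ⨅ (t : ℕ → Set X) (_ : E ⊆ ⋃ n, t n) (_ : ∀ n, Metric.ediam (t n) ≤ r),
          ∑' n, ⨆ _ : (t n).Nonempty, Metric.ediam (t n) ^ (s : ℝ)) 1 one_pos
  simp only [iInf_lt_iff] at hlt
  obtain ⟨U, hU, hd, hsum⟩ := hlt
  obtain ⟨δ, hδ, hδsum⟩ := ENNReal.exists_pos_sum_of_countable
    (ENNReal.div_ne_zero.2 ⟨hε, ENNReal.ofNat_ne_top⟩ : ε / 2 ≠ 0) ℕ
  have hfin : ∀ i, Metric.ediam (U i) ^ (s : ℝ) ≠ ∞ := fun i =>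
    ENNReal.rpow_ne_top_of_nonneg hs0'.le (ne_top_of_le_ne_top ENNReal.one_ne_top (hd i))
  -- The summable perturbation `δ` keeps the weight positive, even for sets of diameter zero, so
  -- that its logarithm can be used.
  refine ⟨U, fun i => (Metric.ediam (U i) ^ (s : ℝ)).toNNReal + δ i, fun i => ?_, hU, ?_, ?_⟩
  · exact add_pos_of_nonneg_of_pos zero_le (hδ i)
  · intro i x hx y hy
    rw [Real.le_rpow_inv_iff_of_pos dist_nonneg (NNReal.coe_nonneg _) hs0']
    have h1 : edist x y ^ (s : ℝ) ≤ Metric.ediam (U i) ^ (s : ℝ) :=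
      ENNReal.rpow_le_rpow (Metric.edist_le_ediam_of_mem hx hy) hs0'.le
    have h2 := ENNReal.toReal_mono (hfin i) h1
    rw [← ENNReal.toReal_rpow, ← dist_edist] at h2
    refine h2.trans ?_
    rw [NNReal.coe_add]
    exact le_add_of_nonneg_right (NNReal.coe_nonneg _)
  · simp only [ENNReal.coe_add, ENNReal.coe_toNNReal (hfin _)]
    rw [ENNReal.tsum_add]
    calc _ ≤ ε / 2 + ε / 2 := by
          gcongr
          refine (ENNReal.tsum_le_tsum fun i => ?_).trans hsum.le
          rcases (U i).eq_empty_or_nonempty with h | h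
          · simp [h, hs0']
          · simp [h]
      _ = ε := ENNReal.add_halves ε

/-- The set of slopes in `[0, 1]` of lines through two small sets whose first coordinates are
separated by more than `ρ` is small. -/
theorem volume_slopes_le {U V : Set (EuclideanSpace ℝ (Fin 2))} {a b ρ : ℝ} (hρ : 0 < ρ)
    (ha : ∀ x ∈ U, ∀ y ∈ U, dist x y ≤ a) (hb : ∀ x ∈ V, ∀ y ∈ V, dist x y ≤ b) :
    volume {t : ℝ | t ∈ Set.Icc (0 : ℝ) 1 ∧ ∃ x ∈ U, ∃ y ∈ V, ρ < |y 0 - x 0| ∧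
      y 1 - x 1 = t * (y 0 - x 0)} ≤ ENNReal.ofReal (2 * (a + b) / ρ) := by
  refine (Real.volume_le_diam _).trans (Metric.ediam_le ?_)
  rintro t ⟨⟨ht0, ht1⟩, x, hx, y, hy, hxy, hs⟩ t' ⟨⟨ht0', ht1'⟩, x', hx', y', hy', hxy', hs'⟩
  rw [edist_dist, Real.dist_eq]
  refine ENNReal.ofReal_le_ofReal ?_
  have c : ∀ (u v : EuclideanSpace ℝ (Fin 2)) (i : Fin 2), |u i - v i| ≤ dist u v := by
    intro u v i
    rw [dist_eq_norm]
    simpa using PiLp.norm_apply_le (u - v) i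
  have hx0 := (c x x' 0).trans (ha x hx x' hx')
  have hx1 := (c x x' 1).trans (ha x hx x' hx')
  have hy0 := (c y y' 0).trans (hb y hy y' hy')
  have hy1 := (c y y' 1).trans (hb y hy y' hy')
  have key : (t - t') * (y 0 - x 0) =
      ((y 1 - y' 1) - (x 1 - x' 1)) - t' * ((y 0 - y' 0) - (x 0 - x' 0)) := by
    linear_combination hs' - hs
  rw [le_div_iff₀ hρ]
  have e1 : |t - t'| * |y 0 - x 0| ≤ 2 * (a + b) := by
    rw [← abs_mul, key]
    have e2 : |(y 1 - y' 1) - (x 1 - x' 1)| ≤ b + a := (abs_sub _ _).trans (add_le_add hy1 hx1)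
    have e3 : |(y 0 - y' 0) - (x 0 - x' 0)| ≤ b + a := (abs_sub _ _).trans (add_le_add hy0 hx0)
    have e4 : |t' * ((y 0 - y' 0) - (x 0 - x' 0))| ≤ b + a := by
      rw [abs_mul, abs_of_nonneg ht0']
      exact (mul_le_of_le_one_left (abs_nonneg _) ht1').trans e3
    linarith [abs_sub ((y 1 - y' 1) - (x 1 - x' 1)) (t' * ((y 0 - y' 0) - (x 0 - x' 0)))]
  exact (mul_le_mul_of_nonneg_left hxy.le (abs_nonneg _)).trans e1

/-- For weights in a common hyperdyadic class, powers of exponent `1 + q + η` are dominated by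
products. -/
theorem rpow_le_exp_mul_mul {w v q η : ℝ} {j : ℕ} (hq : 0 < q) (hη : 0 < η) (hw : 0 < w)
    (hv : 0 < v) (hwj : q ^ j ≤ -Real.log w) (hvj : -Real.log v < q ^ (j + 1)) :
    w ^ (1 + q + η) ≤ Real.exp (-(η * q ^ j)) * (w * v) := by
  have e1 : w * v = Real.exp (Real.log w + Real.log v) := by
    rw [Real.exp_add, Real.exp_log hw, Real.exp_log hv]
  -- The class condition gives `w ^ q ≤ v` and `w ^ η ≤ exp (-(η * q ^ j))`; the remaining factor is
  -- `w`.
  rw [Real.rpow_def_of_pos hw, e1, ← Real.exp_add, Real.exp_le_exp]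
  rw [pow_succ] at hvj
  nlinarith [mul_le_mul_of_nonneg_left hwj hη.le, mul_le_mul_of_nonneg_left hwj hq.le]

/-- If `dimH E < 1 / 2`, then outside of a small set of slopes, the intersection of `E` with lines
of the given slope has very economical coverings. -/
theorem exists_exceptional_slopes {E : Set (EuclideanSpace ℝ (Fin 2))} {s : ℝ≥0}
    (hs : dimH E < s) {q η : ℝ} (hq : 1 < q) (hη : 0 < η) (hsq : (s : ℝ)⁻¹ = 1 + q + η) (J : ℕ)
    {ε : ℝ≥0∞} (hε : ε ≠ 0) :
    ∃ B : Set ℝ, volume B ≤ ε ∧ ∀ t ∈ Set.Icc (0 : ℝ) 1, t ∉ B → ∀ A ⊆ E,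
      (∀ x ∈ A, ∀ y ∈ A, y 1 - x 1 = t * (y 0 - x 0)) →
      ∃ V : ℕ → Set (EuclideanSpace ℝ (Fin 2)), A ⊆ ⋃ k, V k ∧
        ∀ k, Metric.ediam (V k) ≤ ENNReal.ofReal (Real.exp (-(η * q ^ (k + J)))) := by
  have hq0 : 0 < q := by linarith
  -- The bounds `1` and `ε / 8` control `8 (∑ w)²`; the bound `exp (-q ^ J)` forces every class
  -- index to be at least `J`.
  obtain ⟨U, w, hw, hEU, hU, hsum⟩ := exists_cover_of_dimH_lt hs
    (ε := min (min 1 (ε / 8)) (ENNReal.ofReal (Real.exp (-q ^ J)))) (by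
      simp [hε, Real.exp_pos])
  have hw' : ∀ i, (0 : ℝ) < w i := fun i => by exact_mod_cast hw i
  have hlog : ∀ i, q ^ J ≤ -Real.log (w i) := fun i => by
    have h1 : (w i : ℝ≥0∞) ≤ ENNReal.ofReal (Real.exp (-q ^ J)) :=
      (ENNReal.le_tsum i).trans (hsum.trans (min_le_right _ _))
    rw [← ENNReal.ofReal_coe_nnreal, ENNReal.ofReal_le_ofReal_iff (Real.exp_pos _).le] at h1
    have h2 := Real.log_le_log (hw' i) h1
    rw [Real.log_exp] at h2
    linarith
  have hcl : ∀ i, ∃ c : ℕ, q ^ c ≤ -Real.log (w i) ∧ -Real.log (w i) < q ^ (c + 1) := fun i =>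
    exists_nat_pow_near ((one_le_pow₀ hq.le).trans (hlog i)) hq
  choose c hc1 hc2 using hcl
  have hcJ : ∀ i, J ≤ c i := fun i => by
    have := (hlog i).trans_lt (hc2 i)
    have := (pow_lt_pow_iff_right₀ hq).1 this
    omega
  -- Half the target diameter: on a line of slope in `[0, 1]`, distance is at most `√2` times the
  -- horizontal distance.
  set σ : ℕ → ℝ := fun j => Real.exp (-(η * q ^ j)) / 2 with hσ
  have hσ0 : ∀ j, 0 < σ j := fun j => half_pos (Real.exp_pos _)
  let B : ℕ × ℕ → Set ℝ := fun p => {t | c p.1 = c p.2 ∧ t ∈ {t : ℝ | t ∈ Set.Icc (0 : ℝ) 1 ∧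
    ∃ x ∈ U p.1, ∃ y ∈ U p.2, σ (c p.1) < |y 0 - x 0| ∧ y 1 - x 1 = t * (y 0 - x 0)}}
  have hB : ∀ p, volume (B p) ≤ 8 * ((w p.1 : ℝ≥0∞) * w p.2) := fun p => by
    by_cases hp : c p.1 = c p.2
    · refine (measure_mono fun t ht => ht.2).trans
        ((volume_slopes_le (hσ0 _) (hU p.1) (hU p.2)).trans ?_)
      rw [← ENNReal.ofReal_coe_nnreal, ← ENNReal.ofReal_coe_nnreal (p := w p.2),
        ← ENNReal.ofReal_mul (hw' _).le, ← ENNReal.ofReal_ofNat 8,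
        ← ENNReal.ofReal_mul (by norm_num)]
      refine ENNReal.ofReal_le_ofReal ?_
      rw [div_le_iff₀ (hσ0 _), hsq]
      have h1 := rpow_le_exp_mul_mul hq0 hη (hw' p.1) (hw' p.2) (hc1 p.1) (hp ▸ hc2 p.2)
      have h2 := rpow_le_exp_mul_mul hq0 hη (hw' p.2) (hw' p.1) (hp ▸ hc1 p.2) (hc2 p.1)
      simp only [hσ]
      nlinarith
    · have : B p = ∅ := Set.eq_empty_of_forall_notMem fun t ht => hp ht.1
      simp [this]
  refine ⟨⋃ p, B p, ?_, ?_⟩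
  · have h1 : ∑' i, (w i : ℝ≥0∞) ≤ 1 := hsum.trans ((min_le_left _ _).trans (min_le_left _ _))
    have h2 : ∑' i, (w i : ℝ≥0∞) ≤ ε / 8 :=
      hsum.trans ((min_le_left _ _).trans (min_le_right _ _))
    calc volume (⋃ p, B p) ≤ ∑' p : ℕ × ℕ, 8 * ((w p.1 : ℝ≥0∞) * w p.2) :=
          (measure_iUnion_le _).trans (ENNReal.tsum_le_tsum hB)
      _ = 8 * ((∑' i, (w i : ℝ≥0∞)) * ∑' i, (w i : ℝ≥0∞)) := by
          rw [ENNReal.tsum_mul_left, ENNReal.tsum_prod (f := fun i k => (w i : ℝ≥0∞) * w k)]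
          simp_rw [ENNReal.tsum_mul_left, ENNReal.tsum_mul_right]
      _ ≤ 8 * (1 * (ε / 8)) := by gcongr
      _ = ε := by
          rw [one_mul, ENNReal.mul_div_cancel (by norm_num) (by norm_num)]
  · intro t ht htB A hAE hA
    -- All covering sets of one class are merged into a single set: a pair of its points too far
    -- apart would put `t` in the exceptional set.
    refine ⟨fun k => A ∩ ⋃ i ∈ {i | c i = k + J}, U i, fun x hx => ?_, fun k => ?_⟩
    · obtain ⟨i, hi⟩ := Set.mem_iUnion.1 (hEU (hAE hx))
      refine Set.mem_iUnion.2 ⟨c i - J, hx, Set.mem_biUnion (x := i) ?_ hi⟩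
      have := hcJ i
      simp only [Set.mem_ofPred_eq]
      omega
    · refine Metric.ediam_le ?_
      rintro x ⟨hxA, hxU⟩ y ⟨hyA, hyU⟩
      simp only [Set.mem_iUnion, Set.mem_ofPred_eq, exists_prop] at hxU hyU
      obtain ⟨i, hi, hxi⟩ := hxU
      obtain ⟨m, hm, hym⟩ := hyU
      have hle : |y 0 - x 0| ≤ σ (k + J) := by
        by_contra hcon
        push Not at hcon
        exact htB (Set.mem_iUnion.2 ⟨(i, m), hi.trans hm.symm, ht, x, hxi, y, hym,
          by simpa only [hi] using hcon, hA x hxA y hyA⟩)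
      rw [edist_dist]
      refine ENNReal.ofReal_le_ofReal ?_
      rw [dist_comm, EuclideanSpace.dist_eq, Fin.sum_univ_two, Real.dist_eq, Real.dist_eq,
        hA x hxA y hyA, Real.sqrt_le_left (Real.exp_pos _).le, sq_abs, sq_abs]
      have h2 : Real.exp (-(η * q ^ (k + J))) = 2 * σ (k + J) := by simp only [hσ]; ring
      have h3 : (y 0 - x 0) ^ 2 ≤ σ (k + J) ^ 2 := by
        rw [← sq_abs]; exact pow_le_pow_left₀ (abs_nonneg _) hle 2
      have h4 : t ^ 2 ≤ 1 := pow_le_one₀ ht.1 ht.2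
      rw [h2, mul_pow t]
      nlinarith [mul_le_mul_of_nonneg_right h4 (sq_nonneg (y 0 - x 0)), sq_nonneg (σ (k + J))]

/-- Sets of Hausdorff dimension less than `1 / 2` are not Furstenberg sets for inverse logarithmic
gauges. -/
theorem IsFurstenbergSet.one_half_le_dimH {h : ℝ≥0 → ℝ≥0} (hdim : IsDimensionFunction h)
    (hlog : IsInverseLogNearZero h) {E : Set (EuclideanSpace ℝ (Fin 2))}
    (hE : IsFurstenbergSet h E) : 1 / 2 ≤ dimH E := by
  by_contra hcon
  push Not at hcon
  obtain ⟨s, hs, hs2⟩ := ENNReal.lt_iff_exists_nnreal_btwn.1 hcon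
  have hs0 : (0 : ℝ) < s := by
    rcases eq_or_ne s 0 with rfl | h
    · simp at hs
    · exact_mod_cast pos_iff_ne_zero.2 h
  have hs2' : (s : ℝ) < 1 / 2 := by
    have := ENNReal.toReal_strict_mono (by simp) hs2
    simpa using this
  have hp : 2 < (s : ℝ)⁻¹ := by
    rw [lt_inv_comm₀ (by norm_num) hs0]; linarith
  -- The excess of `1/s` over `2` is shared equally between `q - 1` and the separation exponent.
  set η : ℝ := ((s : ℝ)⁻¹ - 2) / 2 with hη
  set q : ℝ := 1 + η with hq
  have hη0 : 0 < η := by rw [hη]; linarith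
  have hq1 : 1 < q := by linarith
  have hsq : (s : ℝ)⁻¹ = 1 + q + η := by rw [hq, hη]; ring
  obtain ⟨ε, hε, hεsum⟩ := ENNReal.exists_pos_sum_of_countable (one_ne_zero : (1 : ℝ≥0∞) ≠ 0) ℕ
  choose B hBvol hB using fun n : ℕ => exists_exceptional_slopes hs hq1 hη0 hsq n
    (ENNReal.coe_ne_zero.2 (hε n).ne')
  obtain ⟨t, ht, htB⟩ : ∃ t ∈ Set.Icc (0 : ℝ) 1, t ∉ ⋃ n, B n := by
    by_contra hc
    push Not at hc
    have h1 : volume (Set.Icc (0 : ℝ) 1) ≤ ∑' n, (ε n : ℝ≥0∞) :=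
      (measure_mono hc).trans ((measure_iUnion_le _).trans (ENNReal.tsum_le_tsum hBvol))
    rw [Real.volume_Icc] at h1
    simp only [sub_zero, ENNReal.ofReal_one] at h1
    exact absurd hεsum (not_lt.2 h1)
  set v : EuclideanSpace ℝ (Fin 2) := !₂[1, t] with hv
  have hv0 : v 0 = 1 := rfl
  have hv1 : v 1 = t := rfl
  have hvn : v ≠ 0 := fun h0 => by
    have := congrArg (fun u : EuclideanSpace ℝ (Fin 2) => u 0) h0
    simp [hv0] at this
  obtain ⟨a, L, hL, hpos⟩ := hE (‖v‖⁻¹ • v) (by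
    simp [norm_smul, inv_mul_cancel₀ (norm_ne_zero_iff.2 hvn)])
  set A := segment ℝ a (a + L • ‖v‖⁻¹ • v) ∩ E with hA
  have hline : ∀ x ∈ A, ∀ y ∈ A, y 1 - x 1 = t * (y 0 - x 0) := by
    have key : ∀ x ∈ A, x 1 - a 1 = t * (x 0 - a 0) := by
      rintro x ⟨hx, -⟩
      rw [segment_eq_image'] at hx
      obtain ⟨θ, -, rfl⟩ := hx
      simp [hv0, hv1]
      ring
    intro x hx y hy
    linear_combination key y hy - key x hx
  choose V hAV hVd using fun n => hB n t ht (fun hn => htB (Set.mem_iUnion.2 ⟨n, hn⟩)) A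
    Set.inter_subset_right hline
  set f : ℕ → ℝ≥0∞ := fun j => (h (Real.toNNReal (Real.exp (-(η * q ^ j)))) : ℝ≥0∞) with hf
  have hzero : hausdorffOuterMeasure h A = 0 := by
    have hr : Tendsto (fun n : ℕ => ENNReal.ofReal (Real.exp (-(η * q ^ n)))) atTop (𝓝 0) := by
      have h1 : Tendsto (fun j : ℕ => η * q ^ j) atTop atTop :=
        (tendsto_pow_atTop_atTop_of_one_lt hq1).const_mul_atTop hη0
      simpa [Function.comp_def] using
        ENNReal.tendsto_ofReal (Real.tendsto_exp_neg_atTop_nhds_zero.comp h1)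
    -- The `n`-th cover starts at class `n`, so its gauge sum is bounded by a tail of a convergent
    -- series.
    have hmk := Measure.mkMetric_le_liminf_tsum A
      (fun n : ℕ => ENNReal.ofReal (Real.exp (-(η * q ^ n)))) hr V
      (Eventually.of_forall fun n k => (hVd n k).trans (ENNReal.ofReal_le_ofReal (by
        rw [Real.exp_le_exp, neg_le_neg_iff]
        gcongr
        · exact hq1.le
        · omega)))
      (Eventually.of_forall hAV) (fun r : ℝ≥0∞ => (h r.toNNReal : ℝ≥0∞))
    rw [← OuterMeasure.coe_mkMetric] at hmk
    refine le_antisymm (hmk.trans ?_) zero_le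
    have hlim := ENNReal.tendsto_sum_nat_add f (hlog.tsum_exp_ne_top hη0 hq1)
    rw [← hlim.liminf_eq]
    refine liminf_le_liminf (Eventually.of_forall fun n => ENNReal.tsum_le_tsum fun k => ?_)
    simp only [hf]
    refine ENNReal.coe_le_coe.2 (hdim.mono ?_)
    exact ENNReal.toNNReal_mono ENNReal.ofReal_ne_top (hVd n k)
  exact hpos.ne' hzero

/-! ### Sparse base 4 expansions. -/

/-- The tower of powers of two `1, 2, 4, 16, 65536, …`. -/
def powTower : ℕ → ℕ
  | 0 => 1
  | i + 1 => 2 ^ powTower i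

theorem powTower_strictMono : StrictMono powTower :=
  strictMono_nat_of_lt_succ fun _ => Nat.lt_two_pow_self

theorem lt_powTower (i : ℕ) : i < powTower i := by
  induction i with
  | zero => exact Nat.one_pos
  | succ i ih => exact lt_of_le_of_lt ih (powTower_strictMono i.lt_succ_self)

/-- The positions of the free digits: the union of the blocks `[powTower i, 2 * powTower i)`. -/
def freePositions : Set ℕ := {k | ∃ i, powTower i ≤ k ∧ k < 2 * powTower i}

/-- These long gaps of zero digits make sparse points nearly rational. -/
theorem notMem_freePositions {i k : ℕ} (h1 : 2 * powTower i ≤ k) (h2 : k < powTower (i + 1)) :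
    k ∉ freePositions := by
  rintro ⟨m, hm1, hm2⟩
  have h3 : m < i + 1 := powTower_strictMono.lt_iff_lt.1 (hm1.trans_lt h2)
  have h4 := powTower_strictMono.monotone (Nat.lt_succ_iff.1 h3)
  omega

theorem infinite_freePositions : freePositions.Infinite :=
  Set.infinite_of_not_bddAbove fun ⟨b, hb⟩ => by
    have := hb (show powTower b ∈ freePositions from ⟨b, le_rfl, by have := lt_powTower b; omega⟩)
    exact absurd (lt_powTower b) (not_lt.2 this)

open Classical in
theorem powTower_le_count (i : ℕ) :
    powTower i ≤ Nat.count (· ∈ freePositions) (2 * powTower i) := by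
  rw [two_mul, Nat.count_add]
  refine le_add_left (le_of_eq ?_)
  refine (Nat.count_iff_forall.2 fun k hk => ?_).symm
  exact ⟨i, by omega, by omega⟩

open Classical in
/-- There are at least logarithmically many free positions below `k`. -/
theorem le_two_mul_two_pow_count (k : ℕ) : k ≤ 2 * 2 ^ Nat.count (· ∈ freePositions) k := by
  rcases lt_or_ge k 2 with hk | hk
  · have : 1 ≤ 2 ^ Nat.count (· ∈ freePositions) k := Nat.one_le_two_pow
    omega
  · have hex : ∃ i, k < 2 * powTower i := ⟨k, by have := lt_powTower k; omega⟩
    -- Block `i` lies entirely below `k` and contributes `powTower i` free positions, while `k < 2 *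
    -- powTower (i + 1) = 2 * 2 ^ powTower i`.
    obtain ⟨i, hi⟩ : ∃ i, Nat.find hex = i + 1 := by
      refine Nat.exists_eq_succ_of_ne_zero fun h0 => ?_
      have := Nat.find_spec hex
      rw [h0] at this
      simp [powTower] at this
      omega
    have h1 := Nat.find_spec hex
    have h2 := Nat.find_min hex (m := i) (by omega)
    rw [hi] at h1
    have h3 : powTower i ≤ Nat.count (· ∈ freePositions) k :=
      (powTower_le_count i).trans (Nat.count_monotone _ (by omega))
    have h4 : powTower (i + 1) ≤ 2 ^ Nat.count (· ∈ freePositions) k :=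
      Nat.pow_le_pow_right (by norm_num) h3
    omega

open Classical in
/-- The base 4 digits obtained by writing the binary digits of `y` to the free positions. -/
noncomputable def sparseDigits (y : ℝ) (k : ℕ) : Fin 4 :=
  if k ∈ freePositions then
    if Real.digits y 2 (Nat.count (· ∈ freePositions) k) = 0 then 0 else 1
  else 0

/-- The real number whose base 4 digits are the binary digits of `y`, written to the free
positions. -/
noncomputable def sparsePoint (y : ℝ) : ℝ := Real.ofDigits (sparseDigits y)

theorem sparseDigits_le_one (y : ℝ) (k : ℕ) : (sparseDigits y k : ℕ) ≤ 1 := by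
  unfold sparseDigits
  split_ifs <;> simp

theorem sparsePoint_mem_Icc (y : ℝ) : sparsePoint y ∈ Set.Icc (0 : ℝ) 1 :=
  ⟨Real.ofDigits_nonneg _, Real.ofDigits_le_one _⟩

theorem ofDigits_eq_head_add {b : ℕ} (d : ℕ → Fin b) :
    Real.ofDigits d = (d 0 : ℕ) * (b : ℝ)⁻¹ + (b : ℝ)⁻¹ * Real.ofDigits fun k => d (k + 1) := by
  rw [Real.ofDigits_eq_sum_add_ofDigits d 1]
  simp [Real.ofDigitsTerm]

/-- Reason for base 4 with digits `0` and `1`: tails stay well below `1`, so expansions with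
different heads cannot meet. -/
theorem ofDigits_four_le_half {d : ℕ → Fin 4} (hd : ∀ k, (d k : ℕ) ≤ 1) :
    Real.ofDigits d ≤ 1 / 2 := by
  rw [ofDigits_eq_head_add]
  have h1 : ((d 0 : ℕ) : ℝ) ≤ 1 := by exact_mod_cast hd 0
  have h2 := Real.ofDigits_le_one fun k => d (k + 1)
  push_cast
  linarith

/-- Sequences of base 4 digits `0` and `1` with distinct heads have separated values. -/
theorem ofDigits_four_separated {d d' : ℕ → Fin 4} (hd : (d 0 : ℕ) = 1) (hd' : (d' 0 : ℕ) = 0)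
    (h1 : ∀ k, (d' k : ℕ) ≤ 1) : 1 / 8 ≤ Real.ofDigits d - Real.ofDigits d' := by
  rw [ofDigits_eq_head_add d, ofDigits_eq_head_add d', hd, hd']
  have h2 := Real.ofDigits_nonneg fun k => d (k + 1)
  have h3 := ofDigits_four_le_half fun k => h1 (k + 1)
  push_cast
  linarith

theorem exists_ofDigits_sum_eq_div {b : ℕ} (hb : 0 < b) (d : ℕ → Fin b) (n : ℕ) :
    ∃ u : ℕ, ∑ i ∈ Finset.range n, Real.ofDigitsTerm d i = u / (b : ℝ) ^ n := by
  have hb' : (b : ℝ) ≠ 0 := by positivity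
  induction n with
  | zero => exact ⟨0, by simp⟩
  | succ n ih =>
    obtain ⟨u, hu⟩ := ih
    refine ⟨u * b + d n, ?_⟩
    rw [Finset.sum_range_succ, hu, Real.ofDigitsTerm]
    push_cast
    field_simp
    ring

/-- The points `sparsePoint y` are extremely close to rationals with small denominators. -/
theorem exists_abs_sparsePoint_sub_le (y : ℝ) (i : ℕ) :
    ∃ u : ℕ, u ≤ 16 ^ powTower i ∧
      |sparsePoint y - u / (16 : ℝ) ^ powTower i| ≤ (((2 : ℝ) ^ powTower (i + 1)) ^ 2)⁻¹ := by
  obtain ⟨u, hu⟩ := exists_ofDigits_sum_eq_div (by norm_num) (sparseDigits y) (2 * powTower i)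
  have h16 : ((4 : ℕ) : ℝ) ^ (2 * powTower i) = 16 ^ powTower i := by
    rw [pow_mul]; norm_num
  rw [h16] at hu
  have hsplit := Real.ofDigits_eq_sum_add_ofDigits (sparseDigits y) (2 * powTower i)
  refine ⟨u, ?_, ?_⟩
  · have h1 : (u : ℝ) / 16 ^ powTower i ≤ 1 := by
      refine le_trans ?_ (Real.ofDigits_le_one (sparseDigits y))
      rw [hsplit, hu]
      have := Real.ofDigits_nonneg fun k => sparseDigits y (k + 2 * powTower i)
      have : 0 ≤ (((4 : ℕ) : ℝ) ^ (2 * powTower i))⁻¹ *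
        Real.ofDigits fun k => sparseDigits y (k + 2 * powTower i) := by positivity
      linarith
    rw [div_le_one (by positivity)] at h1
    exact_mod_cast h1
  -- Truncation after block `i` changes no digit before position `powTower (i + 1)`, where the next
  -- block begins.
  · set d : ℕ → Fin 4 := fun k => if k < 2 * powTower i then sparseDigits y k else 0 with hd
    have hd1 : Real.ofDigits d = u / (16 : ℝ) ^ powTower i := by
      rw [Real.ofDigits_eq_sum_add_ofDigits d (2 * powTower i), ← hu]
      have e1 : (fun k => d (k + 2 * powTower i)) = fun _ => 0 := by
        funext k; simp [hd]
      have e2 : Real.ofDigits (fun _ : ℕ => (0 : Fin 4)) = 0 := by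
        simp [Real.ofDigits, Real.ofDigitsTerm]
      rw [e1, e2, mul_zero, add_zero]
      refine Finset.sum_congr rfl fun k hk => ?_
      simp [Real.ofDigitsTerm, hd, Finset.mem_range.1 hk]
    rw [← hd1, sparsePoint]
    refine (Real.abs_ofDigits_sub_ofDigits_le (n := powTower (i + 1)) fun k hk => ?_).trans
      (le_of_eq ?_)
    · simp only [hd]
      split_ifs with hlt
      · rfl
      · rw [sparseDigits, if_neg (notMem_freePositions (not_lt.1 hlt) hk)]
    · rw [← pow_mul, mul_comm, pow_mul]; norm_num

open Classical in
/-- The inverse of `sparsePoint` has a logarithmic modulus of continuity. -/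
theorem exists_sparsePoint_separated {y y' : ℝ} (hy : y ∈ Set.Ico (0 : ℝ) 1)
    (hy' : y' ∈ Set.Ico (0 : ℝ) 1) (hne : y ≠ y') :
    ∃ k : ℕ, |y - y'| ≤ 3 / (k + 1) ∧
      ((4 : ℝ) ^ k)⁻¹ / 8 ≤ |sparsePoint y - sparsePoint y'| := by
  have hex : ∃ l, Real.digits y 2 l ≠ Real.digits y' 2 l := by
    by_contra hcon
    push Not at hcon
    apply hne
    rw [← Real.ofDigits_digits one_lt_two hy, ← Real.ofDigits_digits one_lt_two hy', funext hcon]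
  set l := Nat.find hex with hl
  have hl1 := Nat.find_spec hex
  have hl2 : ∀ m < l, Real.digits y 2 m = Real.digits y' 2 m := fun m hm =>
    not_not.1 (Nat.find_min hex hm)
  -- The position to which the first differing binary digit is written: the sparse expansions agree
  -- before `k` and differ at `k`.
  set k := Nat.nth (· ∈ freePositions) l with hk
  have hkmem : k ∈ freePositions := Nat.nth_mem_of_infinite infinite_freePositions l
  have hcount : Nat.count (· ∈ freePositions) k = l :=
    Nat.count_nth_of_infinite infinite_freePositions l
  refine ⟨k, ?_, ?_⟩
  · have h1 := Real.abs_ofDigits_sub_ofDigits_le hl2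
    rw [Real.ofDigits_digits one_lt_two hy, Real.ofDigits_digits one_lt_two hy'] at h1
    refine h1.trans ?_
    have h2 := le_two_mul_two_pow_count k
    rw [hcount] at h2
    have h3 : 1 ≤ 2 ^ l := Nat.one_le_two_pow
    have h4 : (k : ℝ) + 1 ≤ 3 * 2 ^ l := by
      have : k + 1 ≤ 3 * 2 ^ l := by omega
      exact_mod_cast this
    rw [le_div_iff₀ (by positivity), inv_mul_le_iff₀ (by positivity)]
    push_cast
    linarith
  · have hagree : ∀ m < k, sparseDigits y m = sparseDigits y' m := fun m hm => by
      unfold sparseDigits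
      split_ifs with h1 h2 h3 h3 <;> try rfl
      all_goals
        have := Nat.count_strict_mono (p := (· ∈ freePositions)) h1 hm
        rw [hcount] at this
        have := hl2 _ this
        simp_all
    have hsum : ∑ m ∈ Finset.range k, Real.ofDigitsTerm (sparseDigits y) m =
        ∑ m ∈ Finset.range k, Real.ofDigitsTerm (sparseDigits y') m :=
      Finset.sum_congr rfl fun m hm => by
        simp [Real.ofDigitsTerm, hagree m (Finset.mem_range.1 hm)]
    have hval : ∀ z : ℝ, sparseDigits z k = if Real.digits z 2 l = 0 then 0 else 1 := fun z => by
      rw [sparseDigits, if_pos hkmem, hcount]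
    have hdiff : sparsePoint y - sparsePoint y' = ((4 : ℝ) ^ k)⁻¹ *
        ((Real.ofDigits fun m => sparseDigits y (m + k)) -
          Real.ofDigits fun m => sparseDigits y' (m + k)) := by
      rw [sparsePoint, sparsePoint, Real.ofDigits_eq_sum_add_ofDigits (sparseDigits y) k,
        Real.ofDigits_eq_sum_add_ofDigits (sparseDigits y') k, hsum]
      push_cast
      ring
    rw [hdiff, abs_mul, abs_of_pos (by positivity : (0 : ℝ) < ((4 : ℝ) ^ k)⁻¹), div_eq_mul_one_div]
    refine mul_le_mul_of_nonneg_left ?_ (by positivity)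
    by_cases h0 : Real.digits y 2 l = 0
    · have h0' : Real.digits y' 2 l ≠ 0 := fun h => hl1 (h0.trans h.symm)
      rw [abs_sub_comm]
      refine (ofDigits_four_separated ?_ ?_ fun m => sparseDigits_le_one _ _).trans (le_abs_self _)
      · simp [hval, h0']
      · simp [hval, h0]
    · have h0' : Real.digits y' 2 l = 0 := by
        have := hl1
        generalize Real.digits y 2 l = a at *
        generalize Real.digits y' 2 l = b at *
        omega
      refine (ofDigits_four_separated ?_ ?_ fun m => sparseDigits_le_one _ _).trans (le_abs_self _)
      · simp [hval, h0]
      · simp [hval, h0']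

/-! ### Positive gauge measure by mass distribution. -/

/-- An inverse logarithmic gauge is bounded below along powers of `4`. -/
theorem IsInverseLogNearZero.exists_le_mul_pow {h : ℝ≥0 → ℝ≥0} (hdim : IsDimensionFunction h)
    (hlog : IsInverseLogNearZero h) :
    ∃ C : ℝ≥0, 0 < C ∧ ∀ k : ℕ, (3 : ℝ) / (k + 1) ≤ C * h ((4 ^ (k + 3))⁻¹) := by
  have hlim : Tendsto (fun k : ℕ => ((4 : ℝ≥0) ^ (k + 3))⁻¹) atTop (𝓝[>] 0) := by
    refine tendsto_nhdsWithin_iff.2 ⟨?_, Eventually.of_forall fun k => by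
      simp⟩
    simp_rw [← inv_pow]
    exact (NNReal.tendsto_pow_atTop_nhds_zero_of_lt_one (by
      rw [inv_lt_one₀ (by norm_num)]; norm_num)).comp (tendsto_add_atTop_nat 3)
  obtain ⟨K, hK⟩ := eventually_atTop.1 (hlim.eventually hlog)
  have hform : ∀ k ≥ K, (h ((4 ^ (k + 3))⁻¹) : ℝ) = 1 / ((k + 3) * Real.log 4) := fun k hk => by
    rw [hK k hk]
    push_cast
    rw [one_div (((4 : ℝ) ^ (k + 3))⁻¹), inv_inv, Real.log_pow]
    push_cast
    rfl
  have hlog4 : 0 < Real.log 4 := Real.log_pos (by norm_num)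
  have hKpos : 0 < h ((4 ^ (K + 3))⁻¹) := by
    have := hform K le_rfl
    have h2 : (0 : ℝ) < h ((4 ^ (K + 3))⁻¹) := by rw [this]; positivity
    exact_mod_cast h2
  -- The first term serves `k ≥ K`, since `3 (k + 3) ≤ 9 (k + 1)`; the second serves `k ≤ K` by
  -- monotonicity of `h`.
  set C : ℝ≥0 := 9 * Real.toNNReal (Real.log 4) + 3 / h ((4 ^ (K + 3))⁻¹) with hC
  have hCr : (C : ℝ) = 9 * Real.log 4 + 3 / h ((4 ^ (K + 3))⁻¹) := by
    rw [hC]; push_cast; rw [Real.coe_toNNReal _ hlog4.le]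
  refine ⟨C, by positivity, fun k => ?_⟩
  rcases le_total K k with hk | hk
  · rw [hform k hk, mul_one_div, div_le_div_iff₀ (by positivity) (by positivity), hCr]
    have h1 : (0 : ℝ) ≤ 3 / h ((4 ^ (K + 3))⁻¹) := by positivity
    have h2 : (0 : ℝ) ≤ k := k.cast_nonneg
    nlinarith [mul_nonneg h1 h2, mul_nonneg h2 hlog4.le]
  · have h1 : h ((4 ^ (K + 3))⁻¹) ≤ h ((4 ^ (k + 3))⁻¹) := hdim.mono (by gcongr; norm_num)
    have h2 : (h ((4 ^ (K + 3))⁻¹) : ℝ) ≤ h ((4 ^ (k + 3))⁻¹) := by exact_mod_cast h1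
    have h3 : (0 : ℝ) < h ((4 ^ (K + 3))⁻¹) := by exact_mod_cast hKpos
    have h4 : (3 : ℝ) / (k + 1) ≤ 3 := div_le_self (by norm_num) (by simp)
    have h5 : (3 : ℝ) ≤ C * h ((4 ^ (K + 3))⁻¹) := by
      rw [hCr, add_mul, div_mul_cancel₀ _ h3.ne']
      have : 0 ≤ 9 * Real.log 4 * (h ((4 ^ (K + 3))⁻¹) : ℝ) := by positivity
      linarith
    exact h4.trans (h5.trans (mul_le_mul_of_nonneg_left h2 C.coe_nonneg))

/-- A set which contains the image of the unit interval under a map whose inverse has modulus of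
continuity `C * h` has positive generalized Hausdorff measure. -/
theorem hausdorffOuterMeasure_pos {h : ℝ≥0 → ℝ≥0} (hdim : IsDimensionFunction h) {C : ℝ≥0}
    (hC : 0 < C) {G : ℝ → EuclideanSpace ℝ (Fin 2)} {A : Set (EuclideanSpace ℝ (Fin 2))}
    (hG : ∀ y ∈ Set.Ico (0 : ℝ) 1, G y ∈ A)
    (hexp : ∀ y ∈ Set.Ico (0 : ℝ) 1, ∀ y' ∈ Set.Ico (0 : ℝ) 1,
      |y - y'| ≤ C * h (nndist (G y) (G y'))) : 0 < hausdorffOuterMeasure h A := by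
  -- The pushforward of Lebesgue measure as an outer measure needs no measurability of `G`.
  set μ : OuterMeasure (EuclideanSpace ℝ (Fin 2)) :=
    (C : ℝ≥0∞)⁻¹ • OuterMeasure.map G (volume.restrict (Set.Ico (0 : ℝ) 1)).toOuterMeasure with hμ
  have hval : ∀ s, μ s = (C : ℝ≥0∞)⁻¹ * volume (G ⁻¹' s ∩ Set.Ico (0 : ℝ) 1) := fun s => by
    rw [hμ]
    simp [Measure.restrict_apply' measurableSet_Ico]
  have hC0 : (C : ℝ≥0∞) ≠ 0 := ENNReal.coe_ne_zero.2 hC.ne'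
  have hle : μ ≤ hausdorffOuterMeasure h := by
    refine OuterMeasure.le_mkMetric _ μ 1 one_pos fun s hs => ?_
    rw [hval, ENNReal.inv_mul_le_iff hC0 ENNReal.coe_ne_top]
    refine (Real.volume_le_diam _).trans (Metric.ediam_le ?_)
    rintro y ⟨hys, hy⟩ y' ⟨hys', hy'⟩
    have h1 : nndist (G y) (G y') ≤ (Metric.ediam s).toNNReal := by
      have h2 := ENNReal.toNNReal_mono (ne_top_of_le_ne_top ENNReal.one_ne_top hs)
        (Metric.edist_le_ediam_of_mem hys hys')
      rwa [edist_nndist, ENNReal.toNNReal_coe] at h2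
    have h3 : nndist y y' ≤ C * h (nndist (G y) (G y')) := by
      rw [← NNReal.coe_le_coe, coe_nndist, Real.dist_eq]
      exact_mod_cast hexp y hy y' hy'
    rw [edist_nndist, ← ENNReal.coe_mul, ENNReal.coe_le_coe]
    exact h3.trans (mul_le_mul_right (hdim.mono h1) _)
  refine lt_of_lt_of_le ?_ (hle A)
  rw [hval]
  refine ENNReal.mul_pos (ENNReal.inv_ne_zero.2 ENNReal.coe_ne_top) ?_
  have : G ⁻¹' A ∩ Set.Ico (0 : ℝ) 1 = Set.Ico 0 1 := Set.inter_eq_right.2 hG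
  simp [this]

/-! ### Diophantine approximation and the choice of intercepts. -/

/-- Rational approximations to `√2` with denominators comparable to `N`. -/
theorem exists_rat_approx_sqrt_two {N : ℕ} (hN : 0 < N) :
    ∃ c m : ℤ, IsCoprime c m ∧ 0 < m ∧ m ≤ N ∧ (N : ℝ) ≤ 4 * m ∧
      |√2 - c / m| * m ≤ 1 / N := by
  obtain ⟨r, hr, hden⟩ := Real.exists_rat_abs_sub_le_and_den_le √2 hN
  have hd : (0 : ℝ) < r.den := by exact_mod_cast r.den_pos
  have hd1 : (1 : ℝ) ≤ r.den := by exact_mod_cast r.den_pos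
  have hN' : (1 : ℝ) ≤ N := by exact_mod_cast hN
  have hrr : (r : ℝ) = r.num / r.den := by exact_mod_cast (Rat.num_div_den r).symm
  refine ⟨r.num, (r.den : ℤ), Int.isCoprime_iff_nat_coprime.2 (by simpa using r.reduced),
    by exact_mod_cast r.den_pos, by exact_mod_cast hden, ?_, ?_⟩
  · rw [hrr] at hr
    set a : ℝ := (r.num : ℝ) with ha
    set d : ℝ := (r.den : ℝ) with hdd
    have hs2 : √2 ^ 2 = 2 := Real.sq_sqrt (by norm_num)
    have hs3 : √2 < 3 / 2 := by
      rw [Real.sqrt_lt' (by norm_num)]; norm_num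
    -- A nonzero integer has absolute value at least one; hence `√2` is badly approximable and the
    -- Dirichlet denominator cannot be much smaller than `N`.
    have hint : (1 : ℝ) ≤ |2 * d ^ 2 - a ^ 2| := by
      have hne : 2 * (r.den : ℤ) ^ 2 - r.num ^ 2 ≠ 0 := by
        intro h0
        have h1 : (√2 : ℝ) ^ 2 = (r : ℝ) ^ 2 := by
          have h2 : 2 * d ^ 2 - a ^ 2 = 0 := by rw [ha, hdd]; exact_mod_cast h0
          rw [hs2, hrr, div_pow, eq_div_iff (by positivity)]
          linarith
        rcases sq_eq_sq_iff_eq_or_eq_neg.1 h1 with h | h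
        · exact irrational_sqrt_two ⟨r, h.symm⟩
        · exact irrational_sqrt_two ⟨-r, by push_cast; exact h.symm⟩
      have := Int.one_le_abs hne
      rw [ha, hdd]
      exact_mod_cast this
    have hle1 : |√2 - a / d| ≤ 1 / 2 := by
      refine hr.trans ?_
      apply one_div_le_one_div_of_le (by norm_num)
      nlinarith
    have hsum : |√2 + a / d| ≤ 4 := by
      rw [abs_le] at hle1 ⊢
      constructor <;> linarith [Real.sqrt_nonneg 2]
    have hprod : 2 * d ^ 2 - a ^ 2 = (√2 - a / d) * (√2 + a / d) * d ^ 2 := by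
      have : (√2 - a / d) * (√2 + a / d) * d ^ 2 = √2 ^ 2 * d ^ 2 - a ^ 2 := by
        field_simp
        ring
      rw [this, hs2]
    rw [hprod, abs_mul, abs_mul, abs_of_pos (by positivity : 0 < d ^ 2)] at hint
    have h5 : (1 : ℝ) ≤ 1 / ((N + 1) * d) * 4 * d ^ 2 := hint.trans (by gcongr)
    have h6 : 1 / ((N + 1) * d) * 4 * d ^ 2 = 4 * d / (N + 1) := by
      field_simp
    rw [h6, le_div_iff₀ (by positivity)] at h5
    push_cast
    linarith
  · rw [hrr] at hr
    push_cast
    calc _ ≤ 1 / ((N + 1) * (r.den : ℝ)) * r.den := by gcongr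
      _ = 1 / (N + 1) := by field_simp
      _ ≤ 1 / N := one_div_le_one_div_of_le (by positivity) (by linarith)

/-- Every window of `N` consecutive integers contains some `j` such that `r + j √2` is close to an
integer. -/
theorem exists_abs_sub_mul_sqrt_two_le {N : ℕ} (hN : 0 < N) (r : ℝ) (j₀ : ℤ) :
    ∃ j k : ℤ, j₀ ≤ j ∧ j < j₀ + N ∧ |r - (k - j * √2)| ≤ 3 / N := by
  obtain ⟨c, m, ⟨a, b, hab⟩, hm, hmN, hNm, hcm⟩ := exists_rat_approx_sqrt_two hN
  have hm' : (0 : ℝ) < m := by exact_mod_cast hm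
  have hN' : (0 : ℝ) < N := by exact_mod_cast hN
  set t : ℝ := r + j₀ * √2 with ht
  set R : ℤ := round (t * m) with hR
  -- As `a` inverts `c` modulo `m`, this solves `R + i c ≡ 0`. The errors are the rounding of `t m`
  -- and the drift from replacing `√2` by `c / m`.
  set i : ℤ := (-R * a) % m with hi
  have hi0 : 0 ≤ i := Int.emod_nonneg _ hm.ne'
  have him : i < m := Int.emod_lt_of_pos _ hm
  obtain ⟨k, hk⟩ : m ∣ R + i * c := by
    have h1 : i = -R * a - m * ((-R * a) / m) := by
      rw [hi, Int.emod_def]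
    rw [h1]
    refine ⟨R * b - c * ((-R * a) / m), ?_⟩
    linear_combination (-R) * hab
  refine ⟨j₀ + i, k, by omega, by omega, ?_⟩
  have hi0' : (0 : ℝ) ≤ i := by exact_mod_cast hi0
  have him' : (i : ℝ) ≤ m := by exact_mod_cast him.le
  have hk' : (k : ℝ) = (R + i * c) / m := by
    rw [eq_div_iff hm'.ne']
    have : (R : ℝ) + i * c = m * k := by exact_mod_cast hk
    linarith
  have e1 : r - (k - ((j₀ + i : ℤ) : ℝ) * √2) = (t * m - R) / m + i * (√2 - c / m) := by
    rw [hk', ht]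
    push_cast
    field_simp
    ring
  rw [e1]
  have e2 : |(t * m - R) / m| ≤ 2 / N := by
    rw [abs_div, abs_of_pos hm', div_le_div_iff₀ hm' hN']
    have := abs_sub_round (t * m)
    rw [← hR] at this
    nlinarith
  have e3 : |i * (√2 - c / m)| ≤ 1 / N := by
    rw [abs_mul, abs_of_nonneg hi0', mul_comm]
    exact (mul_le_mul_of_nonneg_left him' (abs_nonneg _)).trans hcm
  refine (abs_add_le _ _).trans ((add_le_add e2 e3).trans (le_of_eq ?_))
  ring

/-- The intercepts `α` for which the line `y = s x + α` is close to a line with parameters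
`((k - j √2) / n, j / n)`, where `n = powTower i * 2 ^ powTower (i + 1)`. -/
def approxIntercepts (s : ℝ) (i : ℕ) : Set ℝ :=
  {α | ∃ j k : ℤ,
    |α - j / (powTower i * 2 ^ powTower (i + 1))| < (((2 : ℝ) ^ powTower (i + 1)) ^ 2)⁻¹ ∧
    |s - (k - j * √2) / (powTower i * 2 ^ powTower (i + 1))| ≤
      3 * (((2 : ℝ) ^ powTower (i + 1)) ^ 2)⁻¹}

theorem isOpen_approxIntercepts (s : ℝ) (i : ℕ) : IsOpen (approxIntercepts s i) := by
  simp only [approxIntercepts, Set.ofPred_exists]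
  refine isOpen_iUnion fun j => isOpen_iUnion fun k => ?_
  refine IsOpen.and ?_ isOpen_const
  exact isOpen_lt (by fun_prop) continuous_const

theorem one_le_powTower (i : ℕ) : 1 ≤ powTower i := (Nat.zero_le i).trans_lt (lt_powTower i)

/-- A window of `N` consecutive `j` gives values `j / n` spanning less than `N / n = 1 / powTower
i`, so it fits into any interval for large `i`; this is why `n` has the factor `powTower i`. Some
`j` in it approximates `n s` up to `3 / N`, hence `s` up to `3 / N²`. -/
theorem dense_iUnion_approxIntercepts (s : ℝ) (i₀ : ℕ) :
    Dense (⋃ i ≥ i₀, approxIntercepts s i) := by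
  rw [dense_iff_exists_between]
  intro a b hab
  obtain ⟨P, hP⟩ := exists_nat_gt (1 / (b - a))
  set i := max i₀ P with hi
  have hPi : 1 < powTower i * (b - a) := by
    have h1 : (P : ℝ) ≤ powTower i := by
      exact_mod_cast (le_max_right i₀ P).trans (lt_powTower i).le
    have h2 := hP.trans_le h1
    rwa [div_lt_iff₀ (sub_pos.2 hab)] at h2
  set N : ℕ := 2 ^ powTower (i + 1) with hN
  have hN0 : 0 < N := by positivity
  have hN0' : (0 : ℝ) < N := by exact_mod_cast hN0
  have hp1 : (1 : ℝ) ≤ powTower i := by exact_mod_cast one_le_powTower i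
  set n : ℝ := powTower i * N with hn
  have hn0 : 0 < n := by positivity
  obtain ⟨j, k, hj1, hj2, hjk⟩ := exists_abs_sub_mul_sqrt_two_le hN0 (n * s) (⌊a * n⌋ + 1)
  have hNr : (2 : ℝ) ^ powTower (i + 1) = N := by rw [hN]; push_cast; rfl
  refine ⟨j / n, Set.mem_biUnion (x := i) (le_max_left i₀ P) ⟨j, k, ?_, ?_⟩, ?_, ?_⟩
  · rw [hNr, ← hn, sub_self, abs_zero]
    positivity
  · rw [hNr, ← hn]
    have e1 : s - (k - j * √2) / n = (n * s - (k - j * √2)) / n := by field_simp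
    rw [e1, abs_div, abs_of_pos hn0, div_le_iff₀ hn0]
    refine hjk.trans ?_
    rw [hn]
    have e2 : 3 * ((N : ℝ) ^ 2)⁻¹ * (powTower i * N) = 3 / N * powTower i := by
      field_simp
    rw [e2]
    exact le_mul_of_one_le_right (by positivity) hp1
  · rw [lt_div_iff₀ hn0]
    refine (Int.lt_floor_add_one (a * n)).trans_le ?_
    exact_mod_cast hj1
  · rw [div_lt_iff₀ hn0]
    have h1 : (j : ℝ) + 1 ≤ ⌊a * n⌋ + 1 + N := by exact_mod_cast hj2
    have h2 := Int.floor_le (a * n)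
    have h3 : (N : ℝ) < (b - a) * n := by
      rw [hn]
      nlinarith
    nlinarith

/-- By the Baire category theorem, every slope admits an intercept with infinitely many good
approximations. -/
theorem exists_intercept (s : ℝ) :
    ∃ α ∈ Set.Ioo (0 : ℝ) 1, ∀ i₀, ∃ i ≥ i₀, α ∈ approxIntercepts s i := by
  have hd : Dense (⋂ i₀, ⋃ i ≥ i₀, approxIntercepts s i) :=
    dense_iInter_of_isOpen_nat
      (fun i₀ => isOpen_biUnion fun i _ => isOpen_approxIntercepts s i)
      (dense_iUnion_approxIntercepts s)
  obtain ⟨α, hα, h0, h1⟩ := hd.exists_between (zero_lt_one (α := ℝ))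
  refine ⟨α, ⟨h0, h1⟩, fun i₀ => ?_⟩
  have := Set.mem_iInter.1 hα i₀
  simpa using this

/-! ### Covering the set: dimension at most one half. -/

/-- The abscissae `1 / (x + √2)` of the points of the Furstenberg set. -/
noncomputable def sparseAbscissa (y : ℝ) : ℝ := (sparsePoint y + √2)⁻¹

/-- A choice of intercepts which admit infinitely many good approximations. -/
noncomputable def intercept (s : ℝ) : ℝ := (exists_intercept s).choose

theorem intercept_mem_Ioo (s : ℝ) : intercept s ∈ Set.Ioo (0 : ℝ) 1 :=
  (exists_intercept s).choose_spec.1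

theorem exists_intercept_mem_approxIntercepts (s : ℝ) (i₀ : ℕ) :
    ∃ i ≥ i₀, intercept s ∈ approxIntercepts s i :=
  (exists_intercept s).choose_spec.2 i₀

/-- The points with sparse abscissa on the lines with slope in `[-1, 1]` and chosen intercept. -/
def sparseLinePoints : Set (EuclideanSpace ℝ (Fin 2)) :=
  {p | ∃ s ∈ Set.Icc (-1 : ℝ) 1, ∃ y : ℝ, p 0 = sparseAbscissa y ∧ p 1 = s * p 0 + intercept s}

theorem sqrt_two_mem_Ioo : √2 ∈ Set.Ioo (1 : ℝ) (3 / 2) := by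
  constructor
  · rw [Real.lt_sqrt (by norm_num)]; norm_num
  · rw [Real.sqrt_lt' (by norm_num)]; norm_num

/-- The centers of the balls which cover `sparseLinePoints` at the `i`-th scale. -/
noncomputable def coverCenter (i : ℕ) (a : ℕ × ℤ) : EuclideanSpace ℝ (Fin 2) :=
  !₂[((a.1 : ℝ) / 16 ^ powTower i + √2)⁻¹,
    (a.2 : ℝ) / (powTower i * 2 ^ powTower (i + 1) * 16 ^ powTower i) *
      ((a.1 : ℝ) / 16 ^ powTower i + √2)⁻¹]

/-- The indices of the balls which cover `sparseLinePoints` at the `i`-th scale. -/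
noncomputable def coverIndex (i : ℕ) : Finset (ℕ × ℤ) :=
  Finset.range (16 ^ powTower i + 1) ×ˢ
    Finset.Icc (-((9 * (powTower i * 2 ^ powTower (i + 1) * 16 ^ powTower i) : ℕ) : ℤ))
      ((9 * (powTower i * 2 ^ powTower (i + 1) * 16 ^ powTower i) : ℕ) : ℤ)

/-- The exponent `9 * powTower i` collects `powTower i ≤ 2 ^ powTower i` and two factors `16 ^
powTower i`; it is negligible against `powTower (i + 1)`. -/
theorem card_coverIndex_le (i : ℕ) :
    (coverIndex i).card ≤ 64 * 2 ^ (9 * powTower i) * 2 ^ powTower (i + 1) := by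
  rw [coverIndex, Finset.card_product, Finset.card_range, Int.card_Icc]
  set V : ℕ := powTower i * 2 ^ powTower (i + 1) * 16 ^ powTower i with hV
  have h1 : (((9 * V : ℕ) : ℤ) + 1 - -((9 * V : ℕ) : ℤ)).toNat = 18 * V + 1 := by omega
  rw [h1]
  have h2 : 1 ≤ 16 ^ powTower i := Nat.one_le_pow _ _ (by norm_num)
  have h3 : powTower i ≤ 2 ^ powTower i := Nat.lt_two_pow_self.le
  have h4 : 1 ≤ V := by
    have := one_le_powTower i
    rw [hV]
    exact Nat.one_le_iff_ne_zero.2 (by positivity)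
  have h5 : V ≤ 2 ^ powTower i * 2 ^ powTower (i + 1) * 16 ^ powTower i := by
    rw [hV]; gcongr
  have h6 : 2 ^ (9 * powTower i) = 2 ^ powTower i * (16 ^ powTower i * 16 ^ powTower i) := by
    rw [← mul_pow, ← mul_pow, pow_mul]; norm_num
  calc (16 ^ powTower i + 1) * (18 * V + 1)
      ≤ (2 * 16 ^ powTower i) *
        (19 * (2 ^ powTower i * 2 ^ powTower (i + 1) * 16 ^ powTower i)) := by
        gcongr <;> omega
    _ = 38 * (2 ^ powTower i * (16 ^ powTower i * 16 ^ powTower i)) * 2 ^ powTower (i + 1) := by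
        ring
    _ ≤ 64 * 2 ^ (9 * powTower i) * 2 ^ powTower (i + 1) := by
        rw [h6]; gcongr; norm_num

/-- Every point of `sparseLinePoints` is covered at infinitely many scales. -/
theorem exists_dist_coverCenter_le {p : EuclideanSpace ℝ (Fin 2)} (hp : p ∈ sparseLinePoints)
    (i₀ : ℕ) : ∃ i ≥ i₀, ∃ a ∈ coverIndex i,
      dist p (coverCenter i a) ≤ 8 * (((2 : ℝ) ^ powTower (i + 1)) ^ 2)⁻¹ := by
  obtain ⟨s, ⟨hs0, hs1⟩, y, hp0, hp1⟩ := hp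
  obtain ⟨i, hi, j, k, hj, hk⟩ := exists_intercept_mem_approxIntercepts s i₀
  obtain ⟨hα0, hα1⟩ := intercept_mem_Ioo s
  obtain ⟨u, hu, hux⟩ := exists_abs_sparsePoint_sub_le y i
  obtain ⟨hx0, -⟩ := sparsePoint_mem_Icc y
  obtain ⟨ht0, ht1⟩ := sqrt_two_mem_Ioo
  set α := intercept s
  set x := sparsePoint y with hx
  have hP : (1 : ℝ) ≤ powTower i := by exact_mod_cast one_le_powTower i
  have hN : (1 : ℝ) ≤ 2 ^ powTower (i + 1) := one_le_pow₀ (by norm_num)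
  set N : ℝ := 2 ^ powTower (i + 1) with hNdef
  set n : ℝ := powTower i * N with hn
  have hn1 : 1 ≤ n := one_le_mul_of_one_le_of_one_le hP hN
  have hn0 : 0 < n := by linarith
  set M : ℝ := 16 ^ powTower i with hM
  have hM1 : 1 ≤ M := one_le_pow₀ (by norm_num)
  have hM0 : 0 < M := by linarith
  set δ : ℝ := (N ^ 2)⁻¹ with hδ
  have hδ0 : 0 < δ := by positivity
  have hnδ : n * δ ≤ n := mul_le_of_le_one_right hn0.le (inv_le_one_of_one_le₀ (one_le_pow₀ hN))
  have huM : (u : ℝ) ≤ M := by rw [hM]; exact_mod_cast hu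
  have hu0 : (0 : ℝ) ≤ u := u.cast_nonneg
  have hj2 : |(j : ℝ)| ≤ 2 * n := by
    have e1 : (j : ℝ) = n * α - n * (α - j / n) := by field_simp; ring
    have e2 : |n * α| ≤ n := by
      rw [abs_mul, abs_of_pos hn0, abs_of_pos hα0]; nlinarith
    have e3 : |n * (α - j / n)| ≤ n := by
      rw [abs_mul, abs_of_pos hn0]
      exact (mul_le_mul_of_nonneg_left hj.le hn0.le).trans hnδ
    rw [e1]
    linarith [abs_sub (n * α) (n * (α - j / n))]
  have hk2 : |(k : ℝ)| ≤ 7 * n := by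
    have e1 : (k : ℝ) = (n * s - n * (s - (k - j * √2) / n)) + j * √2 := by field_simp; ring
    have e2 : |n * s| ≤ n := by
      rw [abs_mul, abs_of_pos hn0]
      exact mul_le_of_le_one_right hn0.le (abs_le.2 ⟨hs0, hs1⟩)
    have e3 : |n * (s - (k - j * √2) / n)| ≤ 3 * n := by
      rw [abs_mul, abs_of_pos hn0]
      have := mul_le_mul_of_nonneg_left hk hn0.le
      linarith
    have e4 : |j * √2| ≤ 3 * n := by
      rw [abs_mul, abs_of_pos (by linarith : 0 < √2)]
      nlinarith [abs_nonneg (j : ℝ)]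
    rw [e1]
    linarith [abs_add_le (n * s - n * (s - (k - j * √2) / n)) (j * √2),
      abs_sub (n * s) (n * (s - (k - j * √2) / n))]
  -- The pair `(j, k)` enters only through this integer, of size at most `(2 + 7) n M`.
  refine ⟨i, hi, (u, j * u + k * 16 ^ powTower i), ?_, ?_⟩
  · have hv : |(j * u + k * M : ℝ)| ≤ 9 * (n * M) := by
      have e1 : |(j * u : ℝ)| ≤ 2 * n * M := by
        rw [abs_mul, abs_of_nonneg hu0]
        exact mul_le_mul hj2 huM hu0 (by positivity)
      have e2 : |(k * M : ℝ)| ≤ 7 * n * M := by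
        rw [abs_mul, abs_of_pos hM0]
        exact mul_le_mul_of_nonneg_right hk2 hM0.le
      linarith [abs_add_le (j * u : ℝ) (k * M)]
    rw [abs_le] at hv
    simp only [coverIndex, Finset.mem_product, Finset.mem_range, Finset.mem_Icc]
    refine ⟨by omega, ?_, ?_⟩
    · have := hv.1
      rw [hn, hM, hNdef] at this
      exact_mod_cast this
    · have := hv.2
      rw [hn, hM, hNdef] at this
      exact_mod_cast this
  · set X : ℝ := sparseAbscissa y with hX
    have hXdef : X = (x + √2)⁻¹ := rfl
    set X₀ : ℝ := ((u : ℝ) / M + √2)⁻¹ with hX₀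
    have hd1 : 1 ≤ x + √2 := by linarith
    have hd2 : 1 ≤ (u : ℝ) / M + √2 := by
      have : 0 ≤ (u : ℝ) / M := by positivity
      linarith
    have hX1 : 0 < X := by rw [hXdef]; positivity
    have hX2 : X ≤ 1 := inv_le_one_of_one_le₀ hd1
    have hX3 : 0 < X₀ := by rw [hX₀]; positivity
    have hX4 : X₀ ≤ 1 := inv_le_one_of_one_le₀ hd2
    have hXX : |X - X₀| ≤ δ := by
      have e1 : X - X₀ = -(x - u / M) * (X * X₀) := by
        rw [hXdef, hX₀]
        field_simp
        ring
      rw [e1, abs_mul, abs_neg, abs_of_pos (mul_pos hX1 hX3)]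
      exact (mul_le_of_le_one_right (abs_nonneg _) (mul_le_one₀ hX2 hX3.le hX4)).trans hux
    have hc0 : coverCenter i (u, j * u + k * 16 ^ powTower i) 0 = X₀ := rfl
    have hc1 : coverCenter i (u, j * u + k * 16 ^ powTower i) 1 =
        (k - j * √2) / n * X₀ + j / n := by
      have e1 : coverCenter i (u, j * u + k * 16 ^ powTower i) 1 =
        ((j * u + k * 16 ^ powTower i : ℤ) : ℝ) / (n * M) * X₀ := rfl
      -- This identity absorbs the intercept `j / n` into a multiple of `X₀` and cancels `√2`.
      have e2 : X₀ * ((u : ℝ) / M + √2) = 1 := inv_mul_cancel₀ (by positivity)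
      rw [e1]
      push_cast
      rw [← hM]
      have e3 : ((j * u + k * M : ℝ)) / (n * M) * X₀ =
          (k - j * √2) / n * X₀ + j / n * (X₀ * (u / M + √2)) := by
        field_simp
        ring
      rw [e3, e2, mul_one]
    have hY : |p 1 - coverCenter i (u, j * u + k * 16 ^ powTower i) 1| ≤ 5 * δ := by
      have e1 : p 1 - ((k - j * √2) / n * X₀ + j / n) =
          s * (X - X₀) + (s - (k - j * √2) / n) * X₀ + (α - j / n) := by
        rw [hp1, hp0]; ring
      rw [hc1, e1]
      have e2 : |s * (X - X₀)| ≤ δ := by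
        rw [abs_mul]
        exact (mul_le_of_le_one_left (abs_nonneg _) (abs_le.2 ⟨hs0, hs1⟩)).trans hXX
      have e3 : |(s - (k - j * √2) / n) * X₀| ≤ 3 * δ := by
        rw [abs_mul, abs_of_pos hX3]
        exact (mul_le_of_le_one_right (abs_nonneg _) hX4).trans hk
      linarith [abs_add_le (s * (X - X₀) + (s - (k - j * √2) / n) * X₀) (α - j / n),
        abs_add_le (s * (X - X₀)) ((s - (k - j * √2) / n) * X₀)]
    rw [EuclideanSpace.dist_eq, Fin.sum_univ_two, Real.dist_eq, Real.dist_eq, hc0, hp0,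
      Real.sqrt_le_left (by positivity)]
    nlinarith [pow_le_pow_left₀ (abs_nonneg _) hXX 2, pow_le_pow_left₀ (abs_nonneg _) hY 2]

theorem eventually_add_mul_le_mul_two_pow (c : ℝ) {κ : ℝ} (hκ : 0 < κ) :
    ∀ᶠ P : ℕ in atTop, c + 10 * P ≤ κ * 2 ^ P := by
  have h1 := tendsto_pow_const_div_const_pow_of_one_lt 1 (one_lt_two : (1 : ℝ) < 2)
  filter_upwards [h1.eventually_lt_const (by positivity : 0 < κ / 11),
    eventually_ge_atTop ⌈c⌉₊] with P hP hc
  rw [div_lt_div_iff₀ (by positivity) (by norm_num), pow_one] at hP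
  have := Nat.ceil_le.1 hc
  linarith

/-- With `P = powTower i` and `Q = 2 ^ P`, the term is `2 ^ (6 + 4σ + 9P - (2σ - 1)Q)`. A tenth `P`
is kept in reserve to reach `2 ^ (-i)`, using `i ≤ P`. -/
theorem summable_cover_terms {σ : ℝ} (hσ : 1 / 2 < σ) :
    Summable fun i : ℕ => 64 * 2 ^ (9 * powTower i) * 2 ^ powTower (i + 1) *
      (16 * (((2 : ℝ) ^ powTower (i + 1)) ^ 2)⁻¹) ^ σ := by
  have hκ : 0 < 2 * σ - 1 := by linarith
  have hev := (powTower_strictMono.tendsto_atTop).eventually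
    (eventually_add_mul_le_mul_two_pow (6 + 4 * σ) hκ)
  refine Summable.of_norm_bounded_eventually_nat (g := fun i => (1 / 2 : ℝ) ^ i)
    summable_geometric_two ?_
  filter_upwards [hev] with i hi
  rw [Real.norm_of_nonneg (by positivity)]
  have hQ : ((powTower (i + 1) : ℕ) : ℝ) = 2 ^ powTower i := by simp [powTower]
  rw [← hQ] at hi
  set P : ℝ := ((powTower i : ℕ) : ℝ) with hP
  set Q : ℝ := ((powTower (i + 1) : ℕ) : ℝ) with hQdef
  have h2 : (0 : ℝ) < 2 := by norm_num
  have e0 : (2 : ℝ) ^ powTower (i + 1) = (2 : ℝ) ^ Q := (Real.rpow_natCast _ _).symm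
  have e1 : (16 * (((2 : ℝ) ^ Q) ^ 2)⁻¹) ^ σ = (2 : ℝ) ^ ((4 - 2 * Q) * σ) := by
    rw [Real.rpow_mul h2.le, Real.rpow_sub h2, mul_comm 2 Q, Real.rpow_mul h2.le]
    norm_num [div_eq_mul_inv]
  have e2 : (2 : ℝ) ^ (9 * powTower i) = (2 : ℝ) ^ (9 * P) := by
    rw [← Real.rpow_natCast]; push_cast; rfl
  have e3 : (64 : ℝ) = (2 : ℝ) ^ (6 : ℝ) := by norm_num
  have e4 : (1 / 2 : ℝ) ^ i = (2 : ℝ) ^ (-(i : ℝ)) := by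
    rw [Real.rpow_neg h2.le, Real.rpow_natCast, one_div, inv_pow]
  rw [e0, e1, e2, e3, e4, ← Real.rpow_add h2, ← Real.rpow_add h2, ← Real.rpow_add h2]
  refine Real.rpow_le_rpow_of_exponent_le (by norm_num) ?_
  have h5 : (i : ℝ) ≤ P := by rw [hP]; exact_mod_cast (lt_powTower i).le
  linarith

/-- A Borel–Cantelli argument: each point is covered at infinitely many scales, so all scales from
`i₀` on together form a cover, whose sum is the tail of a convergent series. -/
theorem hausdorffMeasure_sparseLinePoints {σ : ℝ} (hσ : 1 / 2 < σ) :
    μH[σ] sparseLinePoints = 0 := by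
  set r : ℕ → ℝ≥0∞ := fun i => ENNReal.ofReal (16 * (((2 : ℝ) ^ powTower (i + 1)) ^ 2)⁻¹) with hr
  have hr_anti : Antitone r := fun i m him => by
    refine ENNReal.ofReal_le_ofReal ?_
    gcongr
    · norm_num
    · exact powTower_strictMono.monotone (by omega)
  have hr0 : Tendsto r atTop (𝓝 0) := by
    have h1 : Tendsto (fun i => powTower (i + 1)) atTop atTop :=
      powTower_strictMono.tendsto_atTop.comp (tendsto_add_atTop_nat 1)
    have h2 : Tendsto (fun i => (((2 : ℝ) ^ powTower (i + 1)) ^ 2)⁻¹) atTop (𝓝 0) :=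
      ((tendsto_pow_atTop two_ne_zero).comp
        ((tendsto_pow_atTop_atTop_of_one_lt one_lt_two).comp h1)).inv_tendsto_atTop
    simpa [hr] using ENNReal.tendsto_ofReal (h2.const_mul 16)
  set T : (i : ℕ) → coverIndex i → Set (EuclideanSpace ℝ (Fin 2)) := fun i a =>
    Metric.closedBall (coverCenter i a) (8 * (((2 : ℝ) ^ powTower (i + 1)) ^ 2)⁻¹) with hT
  have hTd : ∀ i a, Metric.ediam (T i a) ≤ r i := fun i a => by
    refine Metric.ediam_le fun p hp q hq => ?_
    rw [edist_dist]
    refine ENNReal.ofReal_le_ofReal ?_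
    have h1 := dist_triangle_right p q (coverCenter i a)
    have h2 := Metric.mem_closedBall.1 hp
    have h3 := Metric.mem_closedBall.1 hq
    linarith
  set f : ℕ → ℝ≥0∞ := fun i => ENNReal.ofReal (64 * 2 ^ (9 * powTower i) * 2 ^ powTower (i + 1) *
      (16 * (((2 : ℝ) ^ powTower (i + 1)) ^ 2)⁻¹) ^ σ) with hf
  have hTs : ∀ i, ∑' a, Metric.ediam (T i a) ^ σ ≤ f i := fun i => by
    calc ∑' a, Metric.ediam (T i a) ^ σ ≤ ∑' _ : coverIndex i, r i ^ σ :=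
          ENNReal.tsum_le_tsum fun a => ENNReal.rpow_le_rpow (hTd i a) (by linarith)
      _ = (coverIndex i).card * r i ^ σ := by simp
      _ ≤ f i := by
          simp only [hr, hf]
          rw [ENNReal.ofReal_rpow_of_nonneg (by positivity) (by linarith),
            ENNReal.ofReal_mul (by positivity)]
          gcongr
          rw [← ENNReal.ofReal_natCast]
          refine ENNReal.ofReal_le_ofReal ?_
          exact_mod_cast card_coverIndex_le i
  have hmain := Measure.hausdorffMeasure_le_liminf_tsum (l := atTop)
    (ι := fun i₀ : ℕ => Σ m : ℕ, coverIndex (m + i₀)) σ sparseLinePoints r hr0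
    (fun i₀ a => T (a.1 + i₀) a.2)
    (Eventually.of_forall fun i₀ a => (hTd _ _).trans (hr_anti (Nat.le_add_left _ _)))
    (Eventually.of_forall fun i₀ p hp => by
      obtain ⟨i, hi, a, ha, hpa⟩ := exists_dist_coverCenter_le hp i₀
      obtain ⟨m, rfl⟩ := Nat.exists_eq_add_of_le' hi
      exact Set.mem_iUnion.2 ⟨⟨m, a, ha⟩, hpa⟩)
  refine le_antisymm (hmain.trans ?_) zero_le
  have hlim := ENNReal.tendsto_sum_nat_add f (summable_cover_terms hσ).tsum_ofReal_ne_top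
  rw [← hlim.liminf_eq]
  refine liminf_le_liminf (Eventually.of_forall fun i₀ => ?_)
  rw [ENNReal.tsum_sigma']
  exact ENNReal.tsum_le_tsum fun m => hTs (m + i₀)

theorem dimH_sparseLinePoints_le : dimH sparseLinePoints ≤ 1 / 2 := by
  by_contra hcon
  push Not at hcon
  obtain ⟨σ, hσ, hσ2⟩ := ENNReal.lt_iff_exists_nnreal_btwn.1 hcon
  have h1 := hausdorffMeasure_of_lt_dimH hσ2
  have h2 : (1 / 2 : ℝ) < σ := by
    have := ENNReal.toReal_strict_mono ENNReal.coe_ne_top hσ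
    simpa using this
  rw [hausdorffMeasure_sparseLinePoints h2] at h1
  exact ENNReal.zero_ne_top h1

/-! ### The Furstenberg property. -/

/-- The abscissae are parametrized with the modulus of continuity `C * h`. -/
theorem exists_abs_sub_le_mul_abscissa {h : ℝ≥0 → ℝ≥0} (hdim : IsDimensionFunction h)
    (hlog : IsInverseLogNearZero h) :
    ∃ C : ℝ≥0, 0 < C ∧ ∀ y ∈ Set.Ico (0 : ℝ) 1, ∀ y' ∈ Set.Ico (0 : ℝ) 1, ∀ d : ℝ≥0,
      |sparseAbscissa y - sparseAbscissa y'| ≤ d → |y - y'| ≤ C * h d := by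
  obtain ⟨C, hC, hCh⟩ := hlog.exists_le_mul_pow hdim
  refine ⟨C, hC, fun y hy y' hy' d hd => ?_⟩
  rcases eq_or_ne y y' with rfl | hne
  · simp only [sub_self, abs_zero]; positivity
  obtain ⟨k, hk1, hk2⟩ := exists_sparsePoint_separated hy hy' hne
  refine hk1.trans ((hCh k).trans (mul_le_mul_of_nonneg_left ?_ C.coe_nonneg))
  refine NNReal.coe_le_coe.2 (hdim.mono ?_)
  rw [← NNReal.coe_le_coe]
  refine le_trans ?_ hd
  obtain ⟨hx0, hx1⟩ := sparsePoint_mem_Icc y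
  obtain ⟨hx0', hx1'⟩ := sparsePoint_mem_Icc y'
  obtain ⟨ht0, ht1⟩ := sqrt_two_mem_Ioo
  have e1 : sparseAbscissa y - sparseAbscissa y' =
      -(sparsePoint y - sparsePoint y') / ((sparsePoint y + √2) * (sparsePoint y' + √2)) := by
    have h1 : sparsePoint y + √2 ≠ 0 := by positivity
    have h2 : sparsePoint y' + √2 ≠ 0 := by positivity
    rw [sparseAbscissa, sparseAbscissa]
    field_simp
    ring
  rw [e1, abs_div, abs_neg, abs_of_pos (by positivity : 0 < (sparsePoint y + √2) *
    (sparsePoint y' + √2)), le_div_iff₀ (by positivity)]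
  refine le_trans ?_ hk2
  -- This factor `8` and the `8` of the digit separation account for the shift by `3` in `4 ^ (k +
  -- 3)`.
  have e2 : (sparsePoint y + √2) * (sparsePoint y' + √2) ≤ 8 := by nlinarith
  push_cast
  rw [pow_add, mul_inv]
  have e3 : 0 < ((4 : ℝ) ^ k)⁻¹ := by positivity
  nlinarith

/-- Every nonvertical line contains a segment in a given direction, with given orientation, over
the unit interval. -/
theorem exists_segment_param {c d : ℝ} (hc : c ≠ 0) (b : ℝ) :
    ∃ a₀ a₁ L : ℝ, 0 < L ∧ ∀ x ∈ Set.Icc (0 : ℝ) 1, ∃ θ ∈ Set.Icc (0 : ℝ) 1,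
      x = a₀ + θ * (L * c) ∧ d / c * x + b = a₁ + θ * (L * d) := by
  rcases hc.lt_or_gt with hc' | hc'
  · refine ⟨1, d / c + b, -1 / c, div_pos_of_neg_of_neg (by norm_num) hc', fun x hx =>
      ⟨1 - x, ⟨by linarith [hx.2], by linarith [hx.1]⟩, ?_, ?_⟩⟩ <;> field_simp <;> ring
  · refine ⟨0, b, 1 / c, by positivity, fun x hx => ⟨x, hx, ?_, ?_⟩⟩ <;> field_simp <;> ring

/-- Interchanging the coordinates of the plane. -/
def swapCoords (p : EuclideanSpace ℝ (Fin 2)) : EuclideanSpace ℝ (Fin 2) := !₂[p 1, p 0]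

theorem isometry_swapCoords : Isometry swapCoords := by
  refine Isometry.of_dist_eq fun p q => ?_
  rw [EuclideanSpace.dist_eq, EuclideanSpace.dist_eq, Fin.sum_univ_two, Fin.sum_univ_two, add_comm]
  rfl

/-- There are Furstenberg sets for inverse logarithmic gauges of Hausdorff dimension at most
`1 / 2`. -/
theorem isFurstenbergSet_sparseLinePoints {h : ℝ≥0 → ℝ≥0} (hdim : IsDimensionFunction h)
    (hlog : IsInverseLogNearZero h) :
    IsFurstenbergSet h (sparseLinePoints ∪ swapCoords '' sparseLinePoints) := by
  obtain ⟨C, hC, hCh⟩ := exists_abs_sub_le_mul_abscissa hdim hlog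
  have hX : ∀ y, sparseAbscissa y ∈ Set.Icc (0 : ℝ) 1 := fun y => by
    have h1 := (sparsePoint_mem_Icc y).1
    have h2 := sqrt_two_mem_Ioo.1
    exact ⟨inv_nonneg.2 (by linarith), inv_le_one_of_one_le₀ (by linarith)⟩
  have hcoord : ∀ (u v : EuclideanSpace ℝ (Fin 2)) (i : Fin 2), |u i - v i| ≤ nndist u v := by
    intro u v i
    rw [coe_nndist, dist_eq_norm]
    simpa using PiLp.norm_apply_le (u - v) i
  have hmem : ∀ s ∈ Set.Icc (-1 : ℝ) 1, ∀ y,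
      !₂[sparseAbscissa y, s * sparseAbscissa y + intercept s] ∈ sparseLinePoints :=
    fun s hs y => ⟨s, hs, y, rfl, rfl⟩
  have hslope : ∀ c d : ℝ, |d| ≤ |c| → d / c ∈ Set.Icc (-1 : ℝ) 1 := fun c d hcd => by
    rw [Set.mem_Icc, ← abs_le, abs_div]
    exact div_le_one_of_le₀ hcd (abs_nonneg _)
  intro e he
  have hne : ¬ (e 0 = 0 ∧ e 1 = 0) := fun ⟨h0, h1⟩ => by
    have : e = 0 := by ext i; fin_cases i <;> simpa
    simp [this] at he
  -- Slopes in `[-1, 1]` are served by the set itself, steeper directions by its reflected copy.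
  rcases le_total |e 1| |e 0| with hle | hle
  · have h0 : e 0 ≠ 0 := fun h0 => hne ⟨h0, by simpa [h0] using hle⟩
    obtain ⟨a₀, a₁, L, hL, hseg⟩ := exists_segment_param (d := e 1) h0 (intercept (e 1 / e 0))
    refine ⟨!₂[a₀, a₁], L, hL, hausdorffOuterMeasure_pos hdim hC
      (G := fun y => !₂[sparseAbscissa y, e 1 / e 0 * sparseAbscissa y + intercept (e 1 / e 0)])
      (fun y _ => ⟨?_, Or.inl (hmem _ (hslope _ _ hle) y)⟩)
      fun y hy y' hy' => hCh y hy y' hy' _ (hcoord (!₂[_, _]) (!₂[_, _]) 0)⟩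
    obtain ⟨θ, hθ, hθ0, hθ1⟩ := hseg _ (hX y)
    rw [segment_eq_image']
    refine ⟨θ, hθ, ?_⟩
    ext i
    fin_cases i
    · simpa using hθ0.symm
    · simpa using hθ1.symm
  · have h1 : e 1 ≠ 0 := fun h1 => hne ⟨by simpa [h1] using hle, h1⟩
    obtain ⟨a₀, a₁, L, hL, hseg⟩ := exists_segment_param (d := e 0) h1 (intercept (e 0 / e 1))
    refine ⟨!₂[a₁, a₀], L, hL, hausdorffOuterMeasure_pos hdim hC
      (G := fun y => !₂[e 0 / e 1 * sparseAbscissa y + intercept (e 0 / e 1), sparseAbscissa y])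
      (fun y _ => ⟨?_, Or.inr ⟨_, hmem _ (hslope _ _ hle) y, rfl⟩⟩)
      fun y hy y' hy' => hCh y hy y' hy' _ (hcoord (!₂[_, _]) (!₂[_, _]) 1)⟩
    obtain ⟨θ, hθ, hθ0, hθ1⟩ := hseg _ (hX y)
    rw [segment_eq_image']
    refine ⟨θ, hθ, ?_⟩
    ext i
    fin_cases i
    · simpa using hθ1.symm
    · simpa using hθ0.symm

theorem mainTheorem4 (h : ℝ≥0 → ℝ≥0) (hdim : IsDimensionFunction h)
    (hlog : IsInverseLogNearZero h) :
    (∃ E : Set (EuclideanSpace ℝ (Fin 2)), IsFurstenbergSet h E ∧ dimH E ≤ 1 / 2) ∧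
      (∀ E : Set (EuclideanSpace ℝ (Fin 2)), IsFurstenbergSet h E → 1 / 2 ≤ dimH E) := by
  refine ⟨⟨_, isFurstenbergSet_sparseLinePoints hdim hlog, ?_⟩,
    fun E hE => hE.one_half_le_dimH hdim hlog⟩
  rw [dimH_union, isometry_swapCoords.dimH_image, max_self]
  exact dimH_sparseLinePoints_le
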